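/- **Setting.** Let $(p_i)_{i\in I}$ be propositional variables. Formulae of inquisitive modal logic $\mathrm{InqML}$ are given by $\psi ::= p_i \mid \bot \mid \psi\wedge\psi \mid \psi\to\psi \mid \psi\mathbin{\backslash\!\!/}\psi \mid \Box\psi \mid \boxplus\psi$. A *pseudo-model* $\mathbb M=(W,\Sigma,V)$ consists of a non-empty set $W$ of worlds, a map $\Sigma: W\to\mathcal P(\mathcal P(W))\setminus\{\emptyset\}$, and $V:I\to\mathcal P(W)$; it is a *model* if every $\Sigma(w)$ is closed under subsets. Its closure $\mathbb M{\downarrow}=(W,\Sigma{\downarrow},V)$ has $\Sigma{\downarrow}(w)=\{t : t\subseteq s\text{ for some } s\in\Sigma(w)\}$. A *relational pseudo-model* is a two-sorted structure $\mathfrak M=(W,S,\epsilon,E,(P_i)_{i\in I})$ with non-empty sorts $W$ (worlds) and $S$ (states), $\epsilon,E\subseteq W\times S$ and $P_i\subseteq W$, such that, writing $\underline s=\{w : (w,s)\in\epsilon\}$ and $E[w]=\{s : (w,s)\in E\}$, (1) $\underline s=\underline t$ implies $s=t$, and (2) $E[w]\neq\emptyset$ for all $w$. It is a *relational model* if moreover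 (3) whenever $a\subseteq\underline s$ with $s\in E[w]$, then $a=\underline t$ for some $t\in E[w]$. States $s\in S$ are identified with the sets $\underline s\subseteq W$. $\mathfrak M$ encodes the pseudo-model $\mathbb M(\mathfrak M)=(W,\Sigma,V)$ with $\Sigma(w)=\{\underline s : s\in E[w]\}$ and $V(p_i)=P_i$. It is *state-pointed* if it comes with a distinguished $s\in S$. The *inquisitive closure* $(\mathfrak M,s){\downarrow}$ is the relational encoding of $\mathbb M(\mathfrak M){\downarrow}=(W,\Sigma{\downarrow},V)$ whose second sort is $\bigcup_{w}\Sigma{\downarrow}(w)\cup\mathcal P(\underline s)$, with real membership as $\epsilon$; its distinguished state is $\underline s$. *Inquisitive bisimilarity* of state-pointed models, $\mathbb M,s\sim\mathbb M',s'$, means that there are relations $Z_W\subseteq W\times W'$ and $Z_S\subseteq\mathcal P(W)\times\mathcal P(W')$ with $(s,s')\in Z_S$ such that: $Z_W$-related worlds satisfy the same $p_i$; if $(w,w')\in Z_W$, then every $t\in\Sigma(w)$ is $Z_S$-related to some $t'\in\Sigma'(w')$ and vice versa; if $(t,t')\in Z_S$, then every $w\in t$ is $Z_W$-related to some $w'\in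 t'$ and vice versa. For relational models, $\mathfrak M,s\sim\mathfrak M',s'$ means $\mathbb M(\mathfrak M),\underline s\sim\mathbb M(\mathfrak M'),\underline{s'}$. *Standard translation.* The flatness grade is $\flat(p)=\flat(\bot)=\flat(\Box\psi)=\flat(\boxplus\psi)=0$, $\flat(\psi\wedge\chi)=\max\{\flat(\psi),\flat(\chi)\}$, $\flat(\psi\to\chi)=\flat(\chi)$, $\flat(\psi\mathbin{\backslash\!\!/}\chi)=\flat(\psi)+\flat(\chi)+1$. For $\psi\in\mathrm{InqML}$ with $f=\flat(\psi)+1$, put $\psi^*(\lambda)=\forall y_1\cdots y_f\,\bigl(\bigwedge_{l} y_l\in\lambda\to ST(\psi,y_1,\dots,y_f)\bigr)$, where for a tuple $\mathbf x=(x_1,\dots,x_n)$ of world variables - $ST(p_i,\mathbf x)=\bigwedge_k P_ix_k$ and $ST(\bot,\mathbf x)=\bigwedge_k \neg\, x_k=x_k$; - $ST(\psi\wedge\chi,\mathbf x)=ST(\psi,\mathbf x)\wedge ST(\chi,\mathbf x)$ and $ST(\psi\mathbin{\backslash\!\!/}\chi,\mathbf x)=ST(\psi,\mathbf x)\vee ST(\chi,\mathbf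 x)$; - $ST(\psi\to\chi,\mathbf x)=\forall y_1\cdots y_n\,\bigl(\bigwedge_k\bigvee_l y_k=x_l\to(ST(\psi,\mathbf y)\to ST(\chi,\mathbf y))\bigr)$; - $ST(\Box\psi,\mathbf x)=\bigwedge_k\forall y_1\cdots y_f\,\forall\mu_1\cdots\mu_f\,\bigl(\bigwedge_l(Ex_k\mu_l\wedge y_l\in\mu_l)\to ST(\psi,\mathbf y)\bigr)$; - $ST(\boxplus\psi,\mathbf x)=\bigwedge_k\forall\mu\,(Ex_k\mu\to\psi^*(\mu))$. **Statement.** Let $\varphi=\varphi(\lambda)$ be a two-sorted first-order formula with equality in the vocabulary $\epsilon,E,(P_i)_{i\in I}$, with a single free variable $\lambda$, of the state sort. The following are equivalent: (a) all of the following hold: - $\varphi$ and $\neg\varphi$ are preserved under inquisitive closure: for every state-pointed relational pseudo-model $\mathfrak M,s$ with $\underline s\neq\emptyset$, if $\mathfrak M\models\varphi[s]$ then $(\mathfrak M,s){\downarrow}\models\varphi[\underline s]$, and likewise for $\neg\varphi$; - $\varphi$ is preserved under inquisitive bisimulation over state-pointed relational models: if $\mathfrak M,s\sim\mathfrak M',s'$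 for relational models with $\underline s,\underline{s'}\ne\emptyset$, then $\mathfrak M\models\varphi[s]$ implies $\mathfrak M'\models\varphi[s']$; - $\varphi$ is persistent over inquisitive closures: for every state-pointed relational pseudo-model $\mathfrak M,s$ and all non-empty $t\subseteq\underline s$, if $(\mathfrak M,s){\downarrow}\models\varphi[\underline s]$ then $(\mathfrak M,s){\downarrow}\models\varphi[t]$; (b) there is $\psi\in\mathrm{InqML}$ such that $\mathfrak M\models\varphi[s]\Leftrightarrow\mathfrak M\models\psi^*[s]$ for all relational pseudo-models $\mathfrak M$ and all $s\in S$ with $\underline s\neq\emptyset$. -/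

import Mathlib

universe u v

namespace InqML

/-! ### Inquisitive modal formulae -/

/-- Formulae of inquisitive modal logic over propositional variables `p i`, `i : I`. -/
inductive Formula (I : Type u) : Type u
  | atom (i : I) : Formula I
  | bot : Formula I
  | and (φ ψ : Formula I) : Formula I
  | imp (φ ψ : Formula I) : Formula I
  /-- inquisitive disjunction -/
  | idisj (φ ψ : Formula I) : Formula I
  /-- the universal modality `□` -/
  | box (φ : Formula I) : Formula I
  /-- the inquisitive modality `⊞` -/
  | boxplus (φ : Formula I) : Formula I

/-- The flatness grade. -/
def Formula.flat {I : Type u} : Formula I → ℕ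
  | .atom _ => 0
  | .bot => 0
  | .and φ ψ => max φ.flat ψ.flat
  | .imp _ ψ => ψ.flat
  | .idisj φ ψ => φ.flat + ψ.flat + 1
  | .box _ => 0
  | .boxplus _ => 0

/-! ### Two-sorted first-order logic -/

/-- Two-sorted first-order formulae with `m` free world variables and `n` free state variables,
in the relational vocabulary `ε`, `E` (mixed binary) and `P i` (unary on worlds), with equality
on both sorts. A quantifier binds the last variable of its sort; the remaining connectives are
defined classically below. -/
inductive FO (I : Type u) : ℕ → ℕ → Type u
  | falsum {m n : ℕ} : FO I m n
  | eqW {m n : ℕ} (x y : Fin m) : FO I m n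
  | eqS {m n : ℕ} (a b : Fin n) : FO I m n
  | mem {m n : ℕ} (x : Fin m) (a : Fin n) : FO I m n
  | E {m n : ℕ} (x : Fin m) (a : Fin n) : FO I m n
  | P {m n : ℕ} (i : I) (x : Fin m) : FO I m n
  | imp {m n : ℕ} (φ ψ : FO I m n) : FO I m n
  | allW {m n : ℕ} (φ : FO I (m + 1) n) : FO I m n
  | allS {m n : ℕ} (φ : FO I m (n + 1)) : FO I m n

namespace FO

variable {I : Type u} {m n : ℕ}

def neg (φ : FO I m n) : FO I m n := φ.imp falsum
def verum : FO I m n := neg falsum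
def and (φ ψ : FO I m n) : FO I m n := neg (φ.imp ψ.neg)
def or (φ ψ : FO I m n) : FO I m n := φ.neg.imp ψ

/-- The finite conjunction `φ 0 ∧ … ∧ φ (k - 1)`. -/
def conj : (k : ℕ) → (Fin k → FO I m n) → FO I m n
  | 0, _ => verum
  | k + 1, φ => and (conj k (fun i => φ i.castSucc)) (φ (Fin.last k))

/-- The finite disjunction `φ 0 ∨ … ∨ φ (k - 1)`. -/
def disj : (k : ℕ) → (Fin k → FO I m n) → FO I m n
  | 0, _ => falsum
  | k + 1, φ => or (disj k (fun i => φ i.castSucc)) (φ (Fin.last k))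

/-- Universal quantification over the last `k` world variables. -/
def allWs : (k : ℕ) → FO I (m + k) n → FO I m n
  | 0, φ => φ
  | k + 1, φ => allWs k (allW φ)

/-- Universal quantification over the last `k` state variables. -/
def allSs : (k : ℕ) → FO I m (n + k) → FO I m n
  | 0, φ => φ
  | k + 1, φ => allSs k (allS φ)

end FO

/-! ### The standard translation -/

/-- The auxiliary translation `ST(φ, x)` for a tuple `x` of `k` world variables, as a formula in a
context of `m` world variables and `n` state variables. -/
def ST {I : Type u} : Formula I → {m n k : ℕ} → (Fin k → Fin m) → FO I m n
  | .atom i, _, _, k, x => FO.conj k fun j => FO.P i (x j)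
  | .bot, _, _, k, x => FO.conj k fun j => (FO.eqW (x j) (x j)).neg
  | .and φ ψ, _, _, _, x => (ST φ x).and (ST ψ x)
  | .imp φ ψ, m, _, k, x =>
      FO.allWs k
        ((FO.conj k fun j => FO.disj k fun l =>
            FO.eqW (Fin.natAdd m j) (Fin.castAdd k (x l))).imp
          ((ST φ (Fin.natAdd m)).imp (ST ψ (Fin.natAdd m))))
  | .idisj φ ψ, _, _, _, x => (ST φ x).or (ST ψ x)
  | .box φ, m, n, k, x =>
      FO.conj k fun j => FO.allWs (φ.flat + 1) (FO.allSs (φ.flat + 1)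
        ((FO.conj (φ.flat + 1) fun l =>
            (FO.E (Fin.castAdd (φ.flat + 1) (x j)) (Fin.natAdd n l)).and
              (FO.mem (Fin.natAdd m l) (Fin.natAdd n l))).imp
          (ST φ (Fin.natAdd m))))
  | .boxplus φ, m, n, k, x =>
      FO.conj k fun j => FO.allS ((FO.E (x j) (Fin.last n)).imp
        (FO.allWs (φ.flat + 1)
          ((FO.conj (φ.flat + 1) fun l => FO.mem (Fin.natAdd m l) (Fin.last n)).imp
            (ST φ (Fin.natAdd m)))))

/-- The standard translation `φ*(a)`, with one free state variable `a` and no free world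
variable. -/
def standardTranslation {I : Type u} (φ : Formula I) : FO I 0 1 :=
  FO.allWs (φ.flat + 1)
    ((FO.conj (φ.flat + 1) fun l => FO.mem (Fin.natAdd 0 l) 0).imp
      (ST φ (Fin.natAdd 0)))

/-! ### Inquisitive pseudo-models -/

/-- Inquisitive modal pseudo-models `(W, Σ, V)`. -/
structure PseudoModel (I : Type u) where
  W : Type v
  nonempty_W : Nonempty W
  /-- the inquisitive assignment -/
  Sig : W → Set (Set W)
  nonempty_Sig : ∀ w, (Sig w).Nonempty
  /-- the propositional assignment -/
  V : I → Set W

/-- The inquisitive closure of a pseudo-model. -/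
abbrev PseudoModel.closure {I : Type u} (M : PseudoModel.{u, v} I) : PseudoModel.{u, v} I where
  W := M.W
  nonempty_W := M.nonempty_W
  Sig w := {t | ∃ s ∈ M.Sig w, t ⊆ s}
  nonempty_Sig w := (M.nonempty_Sig w).imp fun s hs => ⟨s, hs, subset_rfl⟩
  V := M.V

/-- `ZW` and `ZS` form an inquisitive bisimulation: the world positions and the state positions
from which the second player can survive in the two-phase back-and-forth game. -/
structure IsBisimulation {I : Type u} (M N : PseudoModel.{u, v} I)
    (ZW : M.W → N.W → Prop) (ZS : Set M.W → Set N.W → Prop) : Prop where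
  atoms : ∀ w w', ZW w w' → ∀ i, w ∈ M.V i ↔ w' ∈ N.V i
  world_forth : ∀ w w', ZW w w' → ∀ s ∈ M.Sig w, ∃ s' ∈ N.Sig w', ZS s s'
  world_back : ∀ w w', ZW w w' → ∀ s' ∈ N.Sig w', ∃ s ∈ M.Sig w, ZS s s'
  state_forth : ∀ s s', ZS s s' → ∀ w ∈ s, ∃ w' ∈ s', ZW w w'
  state_back : ∀ s s', ZS s s' → ∀ w' ∈ s', ∃ w ∈ s, ZW w w'

/-- Inquisitive bisimulation equivalence `M, s ∼ N, s'` of state-pointed models. -/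
def StateBisimilar {I : Type u} (M N : PseudoModel.{u, v} I) (s : Set M.W) (s' : Set N.W) :
    Prop :=
  ∃ ZW ZS, IsBisimulation M N ZW ZS ∧ ZS s s'

/-! ### Relational pseudo-models -/

/-- Two-sorted relational structures `(W, S, ε, E, (P i))`. -/
structure RelStructure (I : Type u) where
  W : Type v
  S : Type v
  nonempty_W : Nonempty W
  nonempty_S : Nonempty S
  mem : W → S → Prop
  E : W → S → Prop
  P : I → W → Prop

/-- The set of worlds `{w | (w, s) ∈ ε}` encoded by an element `s` of the second sort. -/
abbrev RelStructure.ext {I : Type u} (A : RelStructure.{u, v} I) (s : A.S) : Set A.W :=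
  {w | A.mem w s}

/-- Truth of a two-sorted formula under an assignment of worlds and states to its variables. -/
def RelStructure.Realize {I : Type u} (A : RelStructure.{u, v} I) :
    {m n : ℕ} → FO I m n → (Fin m → A.W) → (Fin n → A.S) → Prop
  | _, _, .falsum, _, _ => False
  | _, _, .eqW x y, e, _ => e x = e y
  | _, _, .eqS a b, _, f => f a = f b
  | _, _, .mem x a, e, f => A.mem (e x) (f a)
  | _, _, .E x a, e, f => A.E (e x) (f a)
  | _, _, .P i x, e, _ => A.P i (e x)
  | _, _, .imp φ ψ, e, f => A.Realize φ e f → A.Realize ψ e f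
  | _, _, .allW φ, e, f => ∀ w : A.W, A.Realize φ (Fin.snoc (α := fun _ => A.W) e w) f
  | _, _, .allS φ, e, f => ∀ s : A.S, A.Realize φ e (Fin.snoc (α := fun _ => A.S) f s)

/-- `A, s ⊨ φ(a)` for a formula with a single free variable `a` of the state sort. -/
def RelStructure.Sat {I : Type u} (A : RelStructure.{u, v} I) (s : A.S) (φ : FO I 0 1) : Prop :=
  A.Realize φ Fin.elim0 (fun _ => s)

/-- Relational pseudo-models: extensionality, and non-emptiness of every `E[w]`. -/
structure RelPseudoModel (I : Type u) extends RelStructure.{u, v} I where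
  extensional : ∀ s t, toRelStructure.ext s = toRelStructure.ext t → s = t
  nonempty_E : ∀ w, ∃ s, E w s

/-- A relational pseudo-model is a relational model if it is downward closed. -/
def RelPseudoModel.IsModel {I : Type u} (A : RelPseudoModel.{u, v} I) : Prop :=
  ∀ w s, A.E w s → ∀ a : Set A.W, a ⊆ A.ext s → ∃ t, A.E w t ∧ A.ext t = a

/-- The pseudo-model encoded by a relational pseudo-model. -/
abbrev RelPseudoModel.decode {I : Type u} (A : RelPseudoModel.{u, v} I) : PseudoModel.{u, v} I where
  W := A.W
  nonempty_W := A.nonempty_W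
  Sig w := {a | ∃ s, A.E w s ∧ A.ext s = a}
  nonempty_Sig w := (A.nonempty_E w).elim fun s hs => ⟨_, s, hs, rfl⟩
  V i := {w | A.P i w}

/-- The relational encoding of a pseudo-model with second sort `T`, a family of information states
that comprises all `Σ(w)`. -/
abbrev PseudoModel.encode {I : Type u} (M : PseudoModel.{u, v} I) (T : Set (Set M.W))
    (hT : ∀ w, M.Sig w ⊆ T) : RelPseudoModel.{u, v} I where
  W := M.W
  S := T
  nonempty_W := M.nonempty_W
  nonempty_S := M.nonempty_W.elim fun w =>
    (M.nonempty_Sig w).elim fun s hs => ⟨⟨s, hT w hs⟩⟩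
  mem w s := w ∈ s.1
  E w s := s.1 ∈ M.Sig w
  P i w := w ∈ M.V i
  extensional _ _ h := Subtype.ext h
  nonempty_E w := (M.nonempty_Sig w).elim fun s hs => ⟨⟨s, hT w hs⟩, hs⟩

/-- The inquisitive closure `(A, s)↓` of a state-pointed relational pseudo-model: the relational
encoding of the inquisitive closure of the encoded pseudo-model, whose second sort consists of the
information states in its inquisitive assignment and of all subsets of the distinguished state. -/
abbrev RelPseudoModel.inqClosure {I : Type u} (A : RelPseudoModel.{u, v} I) (s : A.S) :
    RelPseudoModel.{u, v} I :=
  A.decode.closure.encode ({t | ∃ w, t ∈ A.decode.closure.Sig w} ∪ {t | t ⊆ A.ext s})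
    fun w _ ht => Or.inl ⟨w, ht⟩

/-- A subset `t` of the distinguished state `s` as an element of the second sort of `(A, s)↓`. -/
def RelPseudoModel.substate {I : Type u} (A : RelPseudoModel.{u, v} I) (s : A.S)
    (t : Set A.W) (ht : t ⊆ A.ext s) : (A.inqClosure s).S :=
  ⟨t, Or.inr ht⟩

/-! ### Semantic conditions on first-order formulae, over non-empty information states -/

/-- `φ` is preserved under passage to inquisitive closures of state-pointed relational
pseudo-models with non-empty distinguished state. -/
def PreservedUnderClosure {I : Type u} (φ : FO I 0 1) : Prop :=
  ∀ (A : RelPseudoModel.{u, v} I) (s : A.S), (A.ext s).Nonempty →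
    A.Sat s φ → (A.inqClosure s).Sat (A.substate s (A.ext s) subset_rfl) φ

/-- `φ` is preserved under inquisitive bisimulation over relational models with non-empty
distinguished states. -/
def PreservedUnderBisimulation {I : Type u} (φ : FO I 0 1) : Prop :=
  ∀ (A B : RelPseudoModel.{u, v} I), A.IsModel → B.IsModel → ∀ (s : A.S) (s' : B.S),
    (A.ext s).Nonempty → (B.ext s').Nonempty →
    StateBisimilar A.decode B.decode (A.ext s) (B.ext s') → A.Sat s φ → B.Sat s' φ

/-- `φ` is persistent, with respect to non-empty information states, over inquisitive closures of
state-pointed relational pseudo-models. -/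
def PersistentOverClosures {I : Type u} (φ : FO I 0 1) : Prop :=
  ∀ (A : RelPseudoModel.{u, v} I) (s : A.S),
    (A.inqClosure s).Sat (A.substate s (A.ext s) subset_rfl) φ →
      ∀ (t : Set A.W) (ht : t ⊆ A.ext s), t.Nonempty →
        (A.inqClosure s).Sat (A.substate s t ht) φ

/-- Logical equivalence over all relational pseudo-models with non-empty distinguished state. -/
def EquivalentOnNonemptyStates {I : Type u} (φ ψ : FO I 0 1) : Prop :=
  ∀ (A : RelPseudoModel.{u, v} I) (s : A.S), (A.ext s).Nonempty → (A.Sat s φ ↔ A.Sat s ψ)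

end InqML

/-! Standard translations define support (`sat_standardTranslation`). Support is persistent,
invariant under bisimulation, and blind to the difference between an inquisitive assignment and its
closure; this gives (b) ⇒ (a). The translation is correct because a formula of flatness grade `n`
fails at a state only if it fails on at most `n + 1` of its worlds, so tuples of that length
suffice.

For (a) ⇒ (b), suppose no `ψ` works. Then any finite list of modal formulae admits a state
satisfying `φ` and a state refuting it such that every listed formula supported at the first is
supported at the second (`exists_separating_models`). Ultraproducts over `ℕ` turn such pairs into
two countably saturated pseudo-models with full inclusion of modal theories over the variables of
`φ`. Between closures of saturated pseudo-models, modal equivalence of worlds is a bisimulation.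
Inclusion of theories, rather than equality, makes the refuting state bisimilar to a substate of the
satisfying one. Passing to the closure, down to the substate by persistence, across the
bisimulation, and back out of the closure (preservation of `¬φ`) carries `φ` to the refuting state,
a contradiction (`sat_of_isSaturated`). -/

namespace InqML

open Set Filter

/-! ### Truth of derived connectives and quantifier blocks. -/

namespace RelStructure

variable {I : Type u} (A : RelStructure.{u, v} I) {m n : ℕ} (e : Fin m → A.W) (f : Fin n → A.S)

theorem realize_neg (φ : FO I m n) : A.Realize φ.neg e f ↔ ¬ A.Realize φ e f := Iff.rfl

theorem realize_verum : A.Realize FO.verum e f := fun h => h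

theorem realize_and (φ ψ : FO I m n) :
    A.Realize (φ.and ψ) e f ↔ A.Realize φ e f ∧ A.Realize ψ e f := by
  simp only [FO.and, FO.neg, Realize]
  tauto

theorem realize_or (φ ψ : FO I m n) :
    A.Realize (φ.or ψ) e f ↔ A.Realize φ e f ∨ A.Realize ψ e f := by
  simp only [FO.or, FO.neg, Realize]
  tauto

theorem realize_conj (k : ℕ) (φ : Fin k → FO I m n) :
    A.Realize (FO.conj k φ) e f ↔ ∀ i, A.Realize (φ i) e f := by
  induction k with
  | zero => exact ⟨fun _ i => i.elim0, fun _ => A.realize_verum e f⟩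
  | succ k ih => rw [FO.conj, realize_and, ih, Fin.forall_fin_succ']

theorem realize_disj (k : ℕ) (φ : Fin k → FO I m n) :
    A.Realize (FO.disj k φ) e f ↔ ∃ i, A.Realize (φ i) e f := by
  induction k with
  | zero => exact ⟨False.elim, fun ⟨i, _⟩ => i.elim0⟩
  | succ k ih => rw [FO.disj, realize_or, ih, Fin.exists_fin_succ']

theorem realize_allWs (k : ℕ) (φ : FO I (m + k) n) :
    A.Realize (FO.allWs k φ) e f ↔ ∀ y : Fin k → A.W, A.Realize φ (Fin.append e y) f := by
  induction k with
  | zero =>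
    refine ⟨fun h y => ?_, fun h => ?_⟩
    · rw [Subsingleton.elim y Fin.elim0, Fin.append_elim0]; exact h
    · have := h Fin.elim0
      rw [Fin.append_elim0] at this; exact this
  | succ k ih =>
    rw [FO.allWs, ih]
    refine ⟨fun h y => ?_, fun h y w => ?_⟩
    · have := h (Fin.init y) (y (Fin.last k))
      rw [← Fin.append_snoc, Fin.snoc_init_self] at this
      exact this
    · rw [← Fin.append_snoc]; exact h _

theorem realize_allSs (k : ℕ) (φ : FO I m (n + k)) :
    A.Realize (FO.allSs k φ) e f ↔ ∀ y : Fin k → A.S, A.Realize φ e (Fin.append f y) := by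
  induction k with
  | zero =>
    refine ⟨fun h y => ?_, fun h => ?_⟩
    · rw [Subsingleton.elim y Fin.elim0, Fin.append_elim0]; exact h
    · have := h Fin.elim0
      rw [Fin.append_elim0] at this; exact this
  | succ k ih =>
    rw [FO.allSs, ih]
    refine ⟨fun h y => ?_, fun h y w => ?_⟩
    · have := h (Fin.init y) (y (Fin.last k))
      rw [← Fin.append_snoc, Fin.snoc_init_self] at this
      exact this
    · rw [← Fin.append_snoc]; exact h _

end RelStructure

/-! ### Support semantics -/

/-- Support of a formula at an information state, over an inquisitive assignment `Sig` and a
propositional assignment `V`. -/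
def Supports {I : Type u} {W : Type v} (Sig : W → Set (Set W)) (V : I → Set W) :
    Formula I → Set W → Prop
  | .atom i, s => s ⊆ V i
  | .bot, s => s = ∅
  | .and φ ψ, s => Supports Sig V φ s ∧ Supports Sig V ψ s
  | .imp φ ψ, s => ∀ t ⊆ s, Supports Sig V φ t → Supports Sig V ψ t
  | .idisj φ ψ, s => Supports Sig V φ s ∨ Supports Sig V ψ s
  | .box φ, s => ∀ w ∈ s, Supports Sig V φ (⋃₀ Sig w)
  | .boxplus φ, s => ∀ w ∈ s, ∀ t ∈ Sig w, Supports Sig V φ t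

section Support

variable {I : Type u} {W : Type v} {Sig : W → Set (Set W)} {V : I → Set W}

theorem Supports.mono {φ : Formula I} {s t : Set W} (h : Supports Sig V φ s) (hts : t ⊆ s) :
    Supports Sig V φ t := by
  induction φ with
  | atom i => exact hts.trans h
  | bot => exact subset_empty_iff.1 (hts.trans (subset_empty_iff.2 h))
  | and φ ψ ih₁ ih₂ => exact ⟨ih₁ h.1, ih₂ h.2⟩
  | imp φ ψ _ _ => exact fun r hr => h r (hr.trans hts)
  | idisj φ ψ ih₁ ih₂ => exact h.imp ih₁ ih₂
  | box φ _ => exact fun w hw => h w (hts hw)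
  | boxplus φ _ => exact fun w hw => h w (hts hw)

theorem supports_empty (φ : Formula I) : Supports Sig V φ ∅ := by
  induction φ with
  | atom i => exact empty_subset _
  | bot => rfl
  | and φ ψ ih₁ ih₂ => exact ⟨ih₁, ih₂⟩
  | imp φ ψ _ ih => intro t ht _; rwa [subset_empty_iff.1 ht]
  | idisj φ ψ ih _ => exact Or.inl ih
  | box φ _ => exact fun w hw => hw.elim
  | boxplus φ _ => exact fun w hw => hw.elim

/-- Formulae of flatness grade `n` are `(n + 1)`-coherent. -/
theorem exists_finset_not_supports {φ : Formula I} {s : Set W} (h : ¬ Supports Sig V φ s) :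
    ∃ t : Finset W, (t : Set W) ⊆ s ∧ t.card ≤ φ.flat + 1 ∧ ¬ Supports Sig V φ t := by
  classical
  have single : ∀ w ∈ s, ¬ Supports Sig V φ {w} →
      ∃ t : Finset W, (t : Set W) ⊆ s ∧ t.card ≤ φ.flat + 1 ∧ ¬ Supports Sig V φ t :=
    fun w hw hn => ⟨{w}, by simpa using hw, by simp, by simpa using hn⟩
  induction φ generalizing s with
  | atom i =>
    obtain ⟨w, hw, hn⟩ := not_subset.1 h
    exact single w hw fun h => hn (h rfl)
  | bot =>
    obtain ⟨w, hw⟩ := nonempty_iff_ne_empty.2 h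
    exact single w hw (singleton_ne_empty w)
  | and φ ψ ih₁ ih₂ =>
    rcases not_and_or.1 h with h | h
    · obtain ⟨t, hts, hc, hn⟩ := ih₁ h fun w hw hn =>
        ⟨{w}, by simpa using hw, by simp, by simpa using hn⟩
      exact ⟨t, hts, hc.trans (by simp [Formula.flat]), fun h => hn h.1⟩
    · obtain ⟨t, hts, hc, hn⟩ := ih₂ h fun w hw hn =>
        ⟨{w}, by simpa using hw, by simp, by simpa using hn⟩
      exact ⟨t, hts, hc.trans (by simp [Formula.flat]), fun h => hn h.2⟩
  | imp φ ψ _ ih =>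
    simp only [Supports, not_forall] at h
    obtain ⟨r, hrs, hφ, hψ⟩ := h
    obtain ⟨t, htr, hc, hn⟩ := ih hψ fun w hw hn =>
        ⟨{w}, by simpa using hw, by simp, by simpa using hn⟩
    -- The small set refuting the consequent inherits the antecedent by persistence, so the
    -- antecedent costs nothing in the grade.
    exact ⟨t, htr.trans hrs, hc, fun h => hn (h _ subset_rfl (hφ.mono htr))⟩
  | idisj φ ψ ih₁ ih₂ =>
    obtain ⟨h₁, h₂⟩ := not_or.1 h
    obtain ⟨t₁, hts₁, hc₁, hn₁⟩ := ih₁ h₁ fun w hw hn =>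
        ⟨{w}, by simpa using hw, by simp, by simpa using hn⟩
    obtain ⟨t₂, hts₂, hc₂, hn₂⟩ := ih₂ h₂ fun w hw hn =>
        ⟨{w}, by simpa using hw, by simp, by simpa using hn⟩
    -- Both disjuncts must fail on the same set; the two cardinality bounds add up, which accounts
    -- for the extra `+ 1` in the grade of `idisj`.
    refine ⟨t₁ ∪ t₂, by simpa using ⟨hts₁, hts₂⟩, ?_, ?_⟩
    · have := Finset.card_union_le t₁ t₂
      simp only [Formula.flat]
      omega
    · rintro (h | h)
      · exact hn₁ (h.mono (by simp))
      · exact hn₂ (h.mono (by simp))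
  | box φ _ =>
    simp only [Supports, not_forall] at h
    obtain ⟨w, hw, hn⟩ := h
    exact single w hw fun h => hn (h w rfl)
  | boxplus φ _ =>
    simp only [Supports, not_forall] at h
    obtain ⟨w, hw, t, ht, hn⟩ := h
    exact single w hw fun h => hn (h w rfl t ht)

/-- Short enumerations are padded by repetition, which needs at least one element to repeat. -/
theorem exists_range_eq {t : Finset W} (ht : t.Nonempty) {n : ℕ} (hn : t.card ≤ n) :
    ∃ y : Fin n → W, range y = t := by
  have : Nonempty t := ht.to_subtype
  obtain ⟨g⟩ : Nonempty (t ↪ Fin n) :=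
    Function.Embedding.nonempty_of_card_le (by simpa using hn)
  refine ⟨fun i => (Function.invFun g i : t), ?_⟩
  rw [range_comp' Subtype.val, (Function.invFun_surjective g.injective).range_eq]
  simp

/-- Coherence in the form used by the translation: it makes support at an arbitrary state
first-order, by quantifying over tuples of fixed length. -/
theorem supports_iff_forall_range (φ : Formula I) (s : Set W) :
    Supports Sig V φ s ↔
      ∀ y : Fin (φ.flat + 1) → W, (∀ l, y l ∈ s) → Supports Sig V φ (range y) := by
  refine ⟨fun h y hy => h.mono (range_subset_iff.2 hy), fun h => ?_⟩
  by_contra hn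
  obtain ⟨t, hts, hc, hn⟩ := exists_finset_not_supports hn
  have hne : t.Nonempty := by
    rw [Finset.nonempty_iff_ne_empty]
    rintro rfl
    exact hn (by simpa using supports_empty φ)
  obtain ⟨y, hy⟩ := exists_range_eq hne hc
  rw [← hy] at hn hts
  exact hn (h y (range_subset_iff.1 hts))

/-- Support does not distinguish inquisitive assignments with the same inquisitive closure. -/
theorem supports_congr_sig {Sig' : W → Set (Set W)} (h₁ : ∀ w, Sig w ⊆ Sig' w)
    (h₂ : ∀ w, ∀ t ∈ Sig' w, ∃ s ∈ Sig w, t ⊆ s) (φ : Formula I) (s : Set W) :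
    Supports Sig V φ s ↔ Supports Sig' V φ s := by
  induction φ generalizing s with
  | atom i => exact Iff.rfl
  | bot => exact Iff.rfl
  | and φ ψ ih₁ ih₂ => exact and_congr (ih₁ s) (ih₂ s)
  | imp φ ψ ih₁ ih₂ => simp only [Supports, ih₁, ih₂]
  | idisj φ ψ ih₁ ih₂ => exact or_congr (ih₁ s) (ih₂ s)
  | box φ ih =>
    have : ∀ w, ⋃₀ Sig w = ⋃₀ Sig' w := fun w =>
      (sUnion_subset_sUnion (h₁ w)).antisymm <| sUnion_subset fun t ht =>
        let ⟨r, hr, htr⟩ := h₂ w t ht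
        htr.trans (subset_sUnion_of_mem hr)
    simp only [Supports, ih, this]
  | boxplus φ ih =>
    simp only [Supports, ih]
    refine forall₂_congr fun w _ => ⟨fun h t ht => ?_, fun h t ht => h t (h₁ w ht)⟩
    obtain ⟨r, hr, htr⟩ := h₂ w t ht
    exact (h r hr).mono htr

/-- The Egli–Milner lifting of a relation to sets. -/
def SetLift {W W' : Type*} (Z : W → W' → Prop) (s : Set W) (s' : Set W') : Prop :=
  (∀ w ∈ s, ∃ w' ∈ s', Z w w') ∧ ∀ w' ∈ s', ∃ w ∈ s, Z w w'

/-- A substate is matched by the set of all partners of its worlds; this is what implication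
requires. -/
theorem SetLift.restrict {W W' : Type*} {Z : W → W' → Prop} {s : Set W} {s' : Set W'}
    (h : SetLift Z s s') {t : Set W} (ht : t ⊆ s) :
    SetLift Z t {w' ∈ s' | ∃ w ∈ t, Z w w'} :=
  ⟨fun w hw => let ⟨w', hw', hz⟩ := h.1 w (ht hw); ⟨w', ⟨hw', w, hw, hz⟩, hz⟩, fun _ hw' => hw'.2⟩

theorem SetLift.restrict' {W W' : Type*} {Z : W → W' → Prop} {s : Set W} {s' : Set W'}
    (h : SetLift Z s s') {t : Set W'} (ht : t ⊆ s') :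
    SetLift Z {w ∈ s | ∃ w' ∈ t, Z w w'} t :=
  ⟨fun _ hw => hw.2, fun w' hw' => let ⟨w, hw, hz⟩ := h.2 w' (ht hw'); ⟨w, ⟨hw, w', hw', hz⟩, hz⟩⟩

/-- The induction runs over the lifting of `ZW` instead of `ZS`: implication passes to substates and
`□` to unions of states, and `ZS` need not contain the resulting pairs. -/
theorem IsBisimulation.supports_iff {M N : PseudoModel.{u, v} I} {ZW : M.W → N.W → Prop}
    {ZS : Set M.W → Set N.W → Prop} (h : IsBisimulation M N ZW ZS) (φ : Formula I)
    {s : Set M.W} {s' : Set N.W} (hs : SetLift ZW s s') :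
    Supports M.Sig M.V φ s ↔ Supports N.Sig N.V φ s' := by
  have lift : ∀ t t', ZS t t' → SetLift ZW t t' := fun t t' ht =>
    ⟨h.state_forth t t' ht, h.state_back t t' ht⟩
  induction φ generalizing s s' with
  | atom i =>
    refine ⟨fun hi w' hw' => ?_, fun hi w hw => ?_⟩
    · obtain ⟨w, hw, hz⟩ := hs.2 w' hw'
      exact (h.atoms w w' hz i).1 (hi hw)
    · obtain ⟨w', hw', hz⟩ := hs.1 w hw
      exact (h.atoms w w' hz i).2 (hi hw')
  | bot =>
    simp only [Supports, eq_empty_iff_forall_notMem]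
    exact ⟨fun hn w' hw' => let ⟨w, hw, _⟩ := hs.2 w' hw'; hn w hw,
      fun hn w hw => let ⟨w', hw', _⟩ := hs.1 w hw; hn w' hw'⟩
  | and φ ψ ih₁ ih₂ => exact and_congr (ih₁ hs) (ih₂ hs)
  | imp φ ψ ih₁ ih₂ =>
    refine ⟨fun hi t ht hφ => ?_, fun hi t ht hφ => ?_⟩
    · have hl := hs.restrict' ht
      exact (ih₂ hl).1 (hi _ (sep_subset _ _) ((ih₁ hl).2 hφ))
    · have hl := hs.restrict ht
      exact (ih₂ hl).2 (hi _ (sep_subset _ _) ((ih₁ hl).1 hφ))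
  | idisj φ ψ ih₁ ih₂ => exact or_congr (ih₁ hs) (ih₂ hs)
  | box φ ih =>
    have union : ∀ w w', ZW w w' → SetLift ZW (⋃₀ M.Sig w) (⋃₀ N.Sig w') := by
      refine fun w w' hz => ⟨?_, ?_⟩
      · rintro x ⟨t, ht, hx⟩
        obtain ⟨t', ht', hz'⟩ := h.world_forth w w' hz t ht
        obtain ⟨x', hx', hz''⟩ := (lift t t' hz').1 x hx
        exact ⟨x', ⟨t', ht', hx'⟩, hz''⟩
      · rintro x' ⟨t', ht', hx'⟩
        obtain ⟨t, ht, hz'⟩ := h.world_back w w' hz t' ht'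
        obtain ⟨x, hx, hz''⟩ := (lift t t' hz').2 x' hx'
        exact ⟨x, ⟨t, ht, hx⟩, hz''⟩
    refine ⟨fun hi w' hw' => ?_, fun hi w hw => ?_⟩
    · obtain ⟨w, hw, hz⟩ := hs.2 w' hw'
      exact (ih (union w w' hz)).1 (hi w hw)
    · obtain ⟨w', hw', hz⟩ := hs.1 w hw
      exact (ih (union w w' hz)).2 (hi w' hw')
  | boxplus φ ih =>
    refine ⟨fun hi w' hw' t' ht' => ?_, fun hi w hw t ht => ?_⟩
    · obtain ⟨w, hw, hz⟩ := hs.2 w' hw'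
      obtain ⟨t, ht, hz'⟩ := h.world_back w w' hz t' ht'
      exact (ih (lift t t' hz')).1 (hi w hw t ht)
    · obtain ⟨w', hw', hz⟩ := hs.1 w hw
      obtain ⟨t', ht', hz'⟩ := h.world_forth w w' hz t ht
      exact (ih (lift t t' hz')).2 (hi w' hw' t' ht')

end Support

/-! ### Correctness of the standard translation -/

section Translation

variable {I : Type u}

/-- The standard translation of `φ` at the state variable `a`, in an arbitrary context. -/
def stateTranslation {m n : ℕ} (φ : Formula I) (a : Fin n) : FO I m n :=
  FO.allWs (φ.flat + 1)
    ((FO.conj (φ.flat + 1) fun l => FO.mem (Fin.natAdd m l) a).imp (ST φ (Fin.natAdd m)))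

namespace RelPseudoModel

variable (A : RelPseudoModel.{u, v} I)

/-- Support in the pseudo-model encoded by `A`. -/
abbrev Supp (φ : Formula I) (s : Set A.W) : Prop :=
  Supports A.decode.Sig A.decode.V φ s

/-- Correctness of `ST` is a hypothesis so that the lemma can serve the `⊞` case of the induction
that proves it. -/
theorem realize_stateTranslation_of_realize_ST {φ : Formula I}
    (h : ∀ {m n k : ℕ} (x : Fin k → Fin m) (e : Fin m → A.W) (f : Fin n → A.S),
      A.Realize (ST φ x) e f ↔ A.Supp φ (range fun j => e (x j)))
    {m n : ℕ} (a : Fin n) (e : Fin m → A.W) (f : Fin n → A.S) :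
    A.Realize (stateTranslation φ a) e f ↔ A.Supp φ (A.ext (f a)) := by
  rw [stateTranslation, RelStructure.realize_allWs, Supp, supports_iff_forall_range]
  simp only [RelStructure.Realize, RelStructure.realize_conj, h, Fin.append_right]
  rfl

/-- A `k`-tuple stands for the finite state of its values. Every non-empty substate of that state is
again listed by a `k`-tuple, so implication needs no longer tuples. -/
theorem realize_ST (φ : Formula I) {m n k : ℕ} (x : Fin k → Fin m) (e : Fin m → A.W)
    (f : Fin n → A.S) : A.Realize (ST φ x) e f ↔ A.Supp φ (range fun j => e (x j)) := by
  induction φ generalizing m n k with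
  | atom i =>
    simp only [ST, RelStructure.realize_conj, RelStructure.Realize, Supports, range_subset_iff]
    rfl
  | bot =>
    simp only [ST, RelStructure.realize_conj, RelStructure.realize_neg, RelStructure.Realize,
      Supports, range_eq_empty_iff, isEmpty_iff, not_true]
  | and φ ψ ih₁ ih₂ => rw [ST, RelStructure.realize_and, ih₁, ih₂]; rfl
  | imp φ ψ ih₁ ih₂ =>
    simp only [ST, RelStructure.realize_allWs, RelStructure.Realize, RelStructure.realize_conj,
      RelStructure.realize_disj, ih₁, ih₂, Fin.append_left, Fin.append_right]
    refine ⟨fun h t ht hφ => ?_, fun h y hy => h _ ?_⟩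
    · rcases t.eq_empty_or_nonempty with rfl | hne
      -- For `k > 0` the empty substate is the range of no tuple, but every formula is supported
      -- there.
      · exact supports_empty ψ
      · have hfin : t.Finite := (finite_range _).subset ht
        obtain ⟨t, rfl⟩ := hfin.exists_finset_coe
        obtain ⟨y, hy⟩ := exists_range_eq (n := k) (Finset.coe_nonempty.1 hne) (by
          classical
          have hsub : t ⊆ Finset.univ.image fun j => e (x j) := by
            rw [← Finset.coe_subset]; simpa using ht
          exact (Finset.card_le_card hsub).trans (Finset.card_image_le.trans (by simp)))
        rw [← hy] at hφ ht ⊢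
        refine h y (fun j => ?_) hφ
        obtain ⟨l, hl⟩ := ht ⟨j, rfl⟩
        exact ⟨l, hl.symm⟩
    · rintro _ ⟨j, rfl⟩
      obtain ⟨l, hl⟩ := hy j
      exact ⟨l, hl.symm⟩
  | idisj φ ψ ih₁ ih₂ => rw [ST, RelStructure.realize_or, ih₁, ih₂]; rfl
  | box φ ih =>
    simp only [ST, RelStructure.realize_conj, RelStructure.realize_allWs,
      RelStructure.realize_allSs, RelStructure.Realize, RelStructure.realize_and, ih, Fin.append_left,
      Fin.append_right, Supports, forall_mem_range]
    refine forall_congr' fun j => ?_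
    rw [supports_iff_forall_range]
    refine forall_congr' fun y => ⟨fun h hy => ?_, fun h μ hμ => h fun l => ?_⟩
    -- Different worlds of the union may lie in different states of `Σ(w)`, hence one state variable
    -- per world variable.
    · choose t ht hyt using hy
      choose μ hμ hμt using ht
      exact h μ fun l => ⟨hμ l, by have := hyt l; rwa [← hμt l] at this⟩
    · exact ⟨A.ext (μ l), ⟨μ l, (hμ l).1, rfl⟩, (hμ l).2⟩
  | boxplus φ ih =>
    have : ST (.boxplus φ) x = FO.conj (I := I) (m := m) (n := n) k fun j =>
        FO.allS ((FO.E (x j) (Fin.last n)).imp (stateTranslation φ (Fin.last n))) := rfl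
    simp only [this, RelStructure.realize_conj, RelStructure.Realize,
      A.realize_stateTranslation_of_realize_ST ih, Fin.snoc_last, Supports, forall_mem_range]
    refine forall_congr' fun j => ⟨?_, fun h t ht => h _ ⟨t, ht, rfl⟩⟩
    rintro h _ ⟨t, ht, rfl⟩
    exact h t ht

theorem realize_stateTranslation (φ : Formula I) {m n : ℕ} (a : Fin n) (e : Fin m → A.W)
    (f : Fin n → A.S) : A.Realize (stateTranslation φ a) e f ↔ A.Supp φ (A.ext (f a)) :=
  A.realize_stateTranslation_of_realize_ST (A.realize_ST φ) a e f

theorem sat_standardTranslation (φ : Formula I) (s : A.S) :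
    A.Sat s (standardTranslation φ) ↔ A.Supp φ (A.ext s) :=
  A.realize_stateTranslation φ 0 _ _

theorem supp_inqClosure (φ : Formula I) (s : A.S) (t : Set A.W) :
    (A.inqClosure s).Supp φ t ↔ A.Supp φ t := by
  refine (supports_congr_sig (fun w a ha => ?_) (fun w t ht => ?_) φ t).symm
  · exact ⟨⟨a, Or.inl ⟨w, a, ha, subset_rfl⟩⟩, ⟨a, ha, subset_rfl⟩, rfl⟩
  · obtain ⟨b, ⟨a, ha, hb⟩, rfl⟩ := ht
    exact ⟨a, ha, hb⟩

theorem isModel_inqClosure (s : A.S) : (A.inqClosure s).IsModel := by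
  rintro w ⟨b, hb⟩ ⟨c, hc, hbc⟩ a ha
  exact ⟨⟨a, Or.inl ⟨w, c, hc, ha.trans hbc⟩⟩, ⟨c, hc, ha.trans hbc⟩, rfl⟩

end RelPseudoModel

/-! ### Semantic properties of standard translations -/

variable {φ : FO I 0 1} {ψ : Formula I}

theorem EquivalentOnNonemptyStates.sat_iff
    (h : EquivalentOnNonemptyStates.{u, v} φ (standardTranslation ψ))
    (A : RelPseudoModel.{u, v} I) (s : A.S) (hs : (A.ext s).Nonempty) :
    A.Sat s φ ↔ A.Supp ψ (A.ext s) :=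
  (h A s hs).trans (A.sat_standardTranslation ψ s)

theorem EquivalentOnNonemptyStates.sat_substate_iff
    (h : EquivalentOnNonemptyStates.{u, v} φ (standardTranslation ψ))
    (A : RelPseudoModel.{u, v} I) (s : A.S) (t : Set A.W) (ht : t ⊆ A.ext s) (hne : t.Nonempty) :
    (A.inqClosure s).Sat (A.substate s t ht) φ ↔ A.Supp ψ t :=
  (h.sat_iff (A.inqClosure s) (A.substate s t ht) hne).trans (A.supp_inqClosure ψ s t)

theorem EquivalentOnNonemptyStates.preservedUnderClosure
    (h : EquivalentOnNonemptyStates.{u, v} φ (standardTranslation ψ)) :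
    PreservedUnderClosure.{u, v} φ ∧ PreservedUnderClosure.{u, v} φ.neg := by
  have key : ∀ (A : RelPseudoModel.{u, v} I) (s : A.S), (A.ext s).Nonempty →
      (A.Sat s φ ↔ (A.inqClosure s).Sat (A.substate s (A.ext s) subset_rfl) φ) :=
    fun A s hs => (h.sat_iff A s hs).trans (h.sat_substate_iff A s _ subset_rfl hs).symm
  exact ⟨fun A s hs => (key A s hs).1, fun A s hs hn hc => hn ((key A s hs).2 hc)⟩

theorem EquivalentOnNonemptyStates.preservedUnderBisimulation
    (h : EquivalentOnNonemptyStates.{u, v} φ (standardTranslation ψ)) :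
    PreservedUnderBisimulation.{u, v} φ := by
  rintro A B - - s s' hs hs' ⟨ZW, ZS, hZ, hss⟩
  rw [h.sat_iff A s hs, h.sat_iff B s' hs']
  exact (hZ.supports_iff ψ ⟨hZ.state_forth _ _ hss, hZ.state_back _ _ hss⟩).1

theorem EquivalentOnNonemptyStates.persistentOverClosures
    (h : EquivalentOnNonemptyStates.{u, v} φ (standardTranslation ψ)) :
    PersistentOverClosures.{u, v} φ := by
  intro A s hs t ht hne
  rw [h.sat_substate_iff A s _ subset_rfl (hne.mono ht)] at hs
  exact (h.sat_substate_iff A s t ht hne).2 (hs.mono ht)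

end Translation

/-! ### Ultraproducts and saturation -/

/-- Diagonalisation over a filter on `ℕ` that contains all cofinite sets. -/
theorem exists_forall_eventually {X : ℕ → Type v} [∀ n, Nonempty (X n)] {l : Filter ℕ}
    (hl : l ≤ atTop) (Q : ℕ → ∀ n, X n → Prop)
    (h : ∀ K, ∀ᶠ n in l, ∃ x, ∀ k < K, Q k n x) :
    ∃ x : ∀ n, X n, ∀ k, ∀ᶠ n in l, Q k n (x n) := by
  classical
  -- At index `n`, solve as many of the first `n` conditions as possible. Zero conditions are always
  -- solvable, and the cap at `n` is needed because `R n` may hold for every `K`.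
  let R : ℕ → ℕ → Prop := fun n K => ∃ x : X n, ∀ k < K, Q k n x
  have hR : ∀ n, R n (Nat.findGreatest (R n) n) := fun n =>
    Nat.findGreatest_spec (P := R n) (Nat.zero_le n)
      ⟨Classical.arbitrary _, fun k hk => absurd hk k.not_lt_zero⟩
  choose x hx using hR
  refine ⟨x, fun k => ?_⟩
  filter_upwards [h (k + 1), hl (eventually_ge_atTop (k + 1))] with n hn hk
  exact hx n k (Nat.le_findGreatest (P := R n) hk hn)

section Ultraproduct

variable {I : Type u}

/-- The ultraproduct of a sequence of relational structures. -/
noncomputable def RelStructure.ultraproduct (U : Ultrafilter ℕ) (A : ℕ → RelStructure.{u, v} I) :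
    RelStructure.{u, v} I where
  W := Quotient (productSetoid (U : Filter ℕ) fun n => (A n).W)
  S := Quotient (productSetoid (U : Filter ℕ) fun n => (A n).S)
  nonempty_W := ⟨Quotient.mk _ fun n => (A n).nonempty_W.some⟩
  nonempty_S := ⟨Quotient.mk _ fun n => (A n).nonempty_S.some⟩
  mem w s := ∀ᶠ n in U, (A n).mem (w.out n) (s.out n)
  E w s := ∀ᶠ n in U, (A n).E (w.out n) (s.out n)
  P i w := ∀ᶠ n in U, (A n).P i (w.out n)

/-- The relations of the ultraproduct are defined through chosen representatives; this exchanges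
them for a prescribed sequence. -/
theorem eventually_out_mk_eq {X : ℕ → Type v} (l : Filter ℕ) (x : ∀ n, X n) :
    ∀ᶠ n in l, (Quotient.mk (productSetoid l X) x).out n = x n :=
  Quotient.mk_out (s := productSetoid l X) x

theorem eq_iff_eventually_out_eq {X : ℕ → Type v} {l : Filter ℕ}
    (x y : Quotient (productSetoid l X)) : x = y ↔ ∀ᶠ n in l, x.out n = y.out n :=
  Quotient.out_equiv_out.symm

theorem out_snoc {X : ℕ → Type v} {l : Filter ℕ} {m : ℕ}
    (e : Fin m → Quotient (productSetoid l X)) (x : Quotient (productSetoid l X)) (n : ℕ) :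
    (fun i => (Fin.snoc (α := fun _ => Quotient (productSetoid l X)) e x i).out n) =
      Fin.snoc (α := fun _ => X n) (fun i => (e i).out n) (x.out n) := by
  ext i
  refine Fin.lastCases ?_ (fun i => ?_) i <;> simp

/-- The quantifier step of Łoś's theorem: if counterexamples exist almost everywhere, choosing them
coordinatewise yields a counterexample in the quotient. -/
theorem eventually_forall_iff {X : ℕ → Type v} {U : Ultrafilter ℕ} [∀ n, Nonempty (X n)]
    (Q : ∀ n, X n → Prop) :
    (∀ x : Quotient (productSetoid (U : Filter ℕ) X), ∀ᶠ n in U, Q n (x.out n)) ↔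
      ∀ᶠ n in U, ∀ x, Q n x := by
  classical
  refine ⟨fun h => ?_, fun h x => h.mono fun n hn => hn _⟩
  by_contra hn
  rw [← Ultrafilter.eventually_not] at hn
  let y : ∀ n, X n := fun n => if hx : ∃ x, ¬ Q n x then hx.choose else Classical.arbitrary _
  obtain ⟨n, h₁, h₂, h₃⟩ := ((h (Quotient.mk _ y)).and
    (hn.and (eventually_out_mk_eq (U : Filter ℕ) y))).exists
  have hx : ∃ x, ¬ Q n x := not_forall.1 h₂
  have hy : y n = hx.choose := dif_pos hx
  rw [h₃, hy] at h₁
  exact hx.choose_spec h₁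

/-- Łoś's theorem for two-sorted relational structures. -/
theorem RelStructure.realize_ultraproduct (U : Ultrafilter ℕ) (A : ℕ → RelStructure.{u, v} I)
    {m k : ℕ} (φ : FO I m k) (e : Fin m → (ultraproduct U A).W)
    (f : Fin k → (ultraproduct U A).S) :
    (ultraproduct U A).Realize φ e f ↔
      ∀ᶠ n in U, (A n).Realize φ (fun i => (e i).out n) (fun i => (f i).out n) := by
  have := fun n => (A n).nonempty_W
  have := fun n => (A n).nonempty_S
  induction φ with
  | falsum => simp [Realize, U.neBot.ne]
  | eqW x y => exact eq_iff_eventually_out_eq _ _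
  | eqS a b => exact eq_iff_eventually_out_eq _ _
  | mem x a => exact Iff.rfl
  | E x a => exact Iff.rfl
  | P i x => exact Iff.rfl
  | imp φ ψ ih₁ ih₂ => simp only [Realize, ih₁, ih₂, Ultrafilter.eventually_imp]
  | allW φ ih =>
    simp only [Realize, ih]
    rw [← eventually_forall_iff]
    refine forall_congr' fun w => eventually_congr (Eventually.of_forall fun n => ?_)
    exact iff_of_eq (congrArg (fun e => (A n).Realize φ e _) (out_snoc e w n))
  | allS φ ih =>
    simp only [Realize, ih]
    rw [← eventually_forall_iff]
    refine forall_congr' fun s => eventually_congr (Eventually.of_forall fun n => ?_)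
    exact iff_of_eq (congrArg (fun f => (A n).Realize φ _ f) (out_snoc f s n))

theorem RelStructure.sat_ultraproduct_mk (U : Ultrafilter ℕ) (A : ℕ → RelStructure.{u, v} I)
    (s : ∀ n, (A n).S) (φ : FO I 0 1) :
    (ultraproduct U A).Sat (Quotient.mk _ s) φ ↔ ∀ᶠ n in U, (A n).Sat (s n) φ := by
  refine (realize_ultraproduct U A φ _ _).trans (eventually_congr ?_)
  filter_upwards [eventually_out_mk_eq (U : Filter ℕ) s] with n hn
  simp only [Sat]
  rw [hn, Subsingleton.elim (fun i => (Fin.elim0 i : (ultraproduct U A).W).out n) Fin.elim0]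

/-- The ultraproduct of a sequence of relational pseudo-models. -/
noncomputable def RelPseudoModel.ultraproduct (U : Ultrafilter ℕ)
    (A : ℕ → RelPseudoModel.{u, v} I) : RelPseudoModel.{u, v} I where
  toRelStructure := RelStructure.ultraproduct U fun n => (A n).toRelStructure
  extensional s t h := by
    have := fun n => (A n).nonempty_W
    -- Extensionality is first-order: equal extensions in the ultraproduct force equal extensions at
    -- almost every coordinate.
    have key : ∀ᶠ n in U, ∀ w, (A n).mem w (s.out n) ↔ (A n).mem w (t.out n) := by
      rw [← eventually_forall_iff]
      intro w
      have hw : (∀ᶠ n in U, (A n).mem (w.out n) (s.out n)) ↔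
          ∀ᶠ n in U, (A n).mem (w.out n) (t.out n) := Set.ext_iff.1 h w
      simp only [iff_iff_implies_and_implies] at hw ⊢
      rw [eventually_and, Ultrafilter.eventually_imp, Ultrafilter.eventually_imp]
      exact hw
    exact (eq_iff_eventually_out_eq s t).2 <|
      key.mono fun n hn => (A n).extensional _ _ (Set.ext hn)
  nonempty_E w := by
    choose s hs using fun n => (A n).nonempty_E (w.out n)
    refine ⟨Quotient.mk _ s, (eventually_out_mk_eq (U : Filter ℕ) s).mono fun n hn => ?_⟩
    rw [hn]
    exact hs n

/-- Realisation of countable types in one variable, with one parameter of the other sort. -/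
structure RelPseudoModel.IsSaturated (A : RelPseudoModel.{u, v} I) : Prop where
  world : ∀ (χ : ℕ → FO I 1 1) (s : A.S),
    (∀ K, ∃ w, ∀ k < K, A.Realize (χ k) (fun _ => w) fun _ => s) →
      ∃ w, ∀ k, A.Realize (χ k) (fun _ => w) fun _ => s
  state : ∀ (χ : ℕ → FO I 1 1) (w : A.W),
    (∀ K, ∃ s, ∀ k < K, A.Realize (χ k) (fun _ => w) fun _ => s) →
      ∃ s, ∀ k, A.Realize (χ k) (fun _ => w) fun _ => s

/-- By Łoś, each finite part of the type is realised at almost every coordinate; diagonalising over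
the coordinates produces a sequence realising the whole type. -/
theorem RelPseudoModel.isSaturated_ultraproduct {U : Ultrafilter ℕ} (hU : (U : Filter ℕ) ≤ atTop)
    (A : ℕ → RelPseudoModel.{u, v} I) : (ultraproduct U A).IsSaturated := by
  have hW := fun n => (A n).nonempty_W
  have hS := fun n => (A n).nonempty_S
  have los : ∀ (χ : FO I 1 1) (w : (ultraproduct U A).W) (s : (ultraproduct U A).S),
      (ultraproduct U A).Realize χ (fun _ => w) (fun _ => s) ↔
        ∀ᶠ n in U, (A n).Realize χ (fun _ => w.out n) fun _ => s.out n :=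
    fun χ w s => RelStructure.realize_ultraproduct U _ χ _ _
  constructor
  · intro χ s h
    obtain ⟨x, hx⟩ := exists_forall_eventually hU
      (fun k n w => (A n).Realize (χ k) (fun _ => w) fun _ => s.out n) fun K => by
        obtain ⟨w, hw⟩ := h K
        have : ∀ᶠ n in U, ∀ k ∈ Iio K, (A n).Realize (χ k) (fun _ => w.out n) fun _ => s.out n :=
          (eventually_all_finite (finite_Iio K)).2 fun k hk => (los _ _ _).1 (hw k hk)
        exact this.mono fun n hn => ⟨w.out n, hn⟩
    refine ⟨Quotient.mk _ x, fun k => (los _ _ _).2 ?_⟩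
    filter_upwards [hx k, eventually_out_mk_eq (U : Filter ℕ) x] with n h₁ h₂
    rwa [h₂]
  · intro χ w h
    obtain ⟨x, hx⟩ := exists_forall_eventually hU
      (fun k n s => (A n).Realize (χ k) (fun _ => w.out n) fun _ => s) fun K => by
        obtain ⟨s, hs⟩ := h K
        have : ∀ᶠ n in U, ∀ k ∈ Iio K, (A n).Realize (χ k) (fun _ => w.out n) fun _ => s.out n :=
          (eventually_all_finite (finite_Iio K)).2 fun k hk => (los _ _ _).1 (hs k hk)
        exact this.mono fun n hn => ⟨s.out n, hn⟩
    refine ⟨Quotient.mk _ x, fun k => (los _ _ _).2 ?_⟩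
    filter_upwards [hx k, eventually_out_mk_eq (U : Filter ℕ) x] with n h₁ h₂
    rwa [h₂]

end Ultraproduct

/-! ### Formulae over a set of propositional variables -/

section Atoms

variable {I : Type u}

/-- The propositional variables of a modal formula. -/
def Formula.atoms : Formula I → Set I
  | .atom i => {i}
  | .bot => ∅
  | .and φ ψ => φ.atoms ∪ ψ.atoms
  | .imp φ ψ => φ.atoms ∪ ψ.atoms
  | .idisj φ ψ => φ.atoms ∪ ψ.atoms
  | .box φ => φ.atoms
  | .boxplus φ => φ.atoms

/-- A numbering of modal formulae, given a numbering of the propositional variables. -/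
def Formula.code (g : I → ℕ) : Formula I → ℕ
  | .atom i => Nat.pair 0 (g i)
  | .bot => Nat.pair 1 0
  | .and φ ψ => Nat.pair 2 (Nat.pair (φ.code g) (ψ.code g))
  | .imp φ ψ => Nat.pair 3 (Nat.pair (φ.code g) (ψ.code g))
  | .idisj φ ψ => Nat.pair 4 (Nat.pair (φ.code g) (ψ.code g))
  | .box φ => Nat.pair 5 (φ.code g)
  | .boxplus φ => Nat.pair 6 (φ.code g)

theorem Formula.code_injOn {g : I → ℕ} {J : Set I} (hg : InjOn g J) :
    InjOn (Formula.code g) {ψ | ψ.atoms ⊆ J} := by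
  intro φ hφ ψ hψ h
  induction φ generalizing ψ with
  | atom i =>
    cases ψ <;> simp [Formula.code, Nat.pair_eq_pair] at h
    rw [hg (hφ rfl) (hψ rfl) h]
  | bot => cases ψ <;> simp [Formula.code, Nat.pair_eq_pair] at h; rfl
  | and φ₁ φ₂ ih₁ ih₂ =>
    cases ψ <;> simp [Formula.code, Nat.pair_eq_pair] at h
    have h₁ := union_subset_iff.1 hφ
    have h₂ := union_subset_iff.1 hψ
    rw [ih₁ h₁.1 h₂.1 h.1, ih₂ h₁.2 h₂.2 h.2]
  | imp φ₁ φ₂ ih₁ ih₂ =>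
    cases ψ <;> simp [Formula.code, Nat.pair_eq_pair] at h
    have h₁ := union_subset_iff.1 hφ
    have h₂ := union_subset_iff.1 hψ
    rw [ih₁ h₁.1 h₂.1 h.1, ih₂ h₁.2 h₂.2 h.2]
  | idisj φ₁ φ₂ ih₁ ih₂ =>
    cases ψ <;> simp [Formula.code, Nat.pair_eq_pair] at h
    have h₁ := union_subset_iff.1 hφ
    have h₂ := union_subset_iff.1 hψ
    rw [ih₁ h₁.1 h₂.1 h.1, ih₂ h₁.2 h₂.2 h.2]
  | box φ ih =>
    cases ψ <;> simp [Formula.code, Nat.pair_eq_pair] at h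
    exact congrArg Formula.box (ih hφ (by exact hψ) h)
  | boxplus φ ih =>
    cases ψ <;> simp [Formula.code, Nat.pair_eq_pair] at h
    exact congrArg Formula.boxplus (ih hφ (by exact hψ) h)

/-- The index set of propositional variables is arbitrary, whereas saturation handles only sequences
of formulae; restricting to countably many variables closes the gap. -/
theorem exists_enumeration {J : Set I} (hJ : J.Countable) :
    ∃ ψ : ℕ → Formula I, {χ | χ.atoms ⊆ J} = range ψ := by
  obtain ⟨g, hg⟩ := countable_iff_exists_injOn.1 hJ
  exact (countable_iff_exists_injOn.2 ⟨_, Formula.code_injOn hg⟩).exists_eq_range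
    ⟨.bot, empty_subset J⟩

/-- Finite conjunctions. -/
def Formula.conj : List (Formula I) → Formula I
  | [] => .imp .bot .bot
  | ψ :: l => .and ψ (conj l)

/-- Finite inquisitive disjunctions. -/
def Formula.disj : List (Formula I) → Formula I
  | [] => .bot
  | ψ :: l => .idisj ψ (disj l)

theorem Formula.atoms_conj {J : Set I} {l : List (Formula I)} (h : ∀ ψ ∈ l, ψ.atoms ⊆ J) :
    (conj l).atoms ⊆ J := by
  induction l with
  | nil => simp [conj, atoms]
  | cons ψ l ih =>
    exact union_subset (h ψ (by simp)) (ih fun χ hχ => h χ (by simp [hχ]))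

theorem Formula.atoms_disj {J : Set I} {l : List (Formula I)} (h : ∀ ψ ∈ l, ψ.atoms ⊆ J) :
    (disj l).atoms ⊆ J := by
  induction l with
  | nil => simp [disj, atoms]
  | cons ψ l ih =>
    exact union_subset (h ψ (by simp)) (ih fun χ hχ => h χ (by simp [hχ]))

section

variable {W : Type v} {Sig : W → Set (Set W)} {V : I → Set W} {s : Set W}

theorem supports_conj {l : List (Formula I)} :
    Supports Sig V (Formula.conj l) s ↔ ∀ ψ ∈ l, Supports Sig V ψ s := by
  induction l with
  | nil => simp [Formula.conj, Supports]
  | cons ψ l ih => simp [Formula.conj, Supports, ih]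

/-- Non-emptiness matters because the empty disjunction `⊥` is supported at the empty state. -/
theorem supports_disj {l : List (Formula I)} (hs : s.Nonempty) :
    Supports Sig V (Formula.disj l) s ↔ ∃ ψ ∈ l, Supports Sig V ψ s := by
  induction l with
  | nil => simp [Formula.disj, Supports, hs.ne_empty]
  | cons ψ l ih => simp [Formula.disj, Supports, ih]

theorem supports_neg {ψ : Formula I} :
    Supports Sig V (ψ.imp .bot) s ↔ ∀ w ∈ s, ¬ Supports Sig V ψ {w} := by
  refine ⟨fun h w hw hψ => singleton_ne_empty w (h {w} (singleton_subset_iff.2 hw) hψ),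
    fun h t ht hψ => eq_empty_iff_forall_notMem.2 fun w hw => ?_⟩
  exact h w (ht hw) (hψ.mono (singleton_subset_iff.2 hw))

theorem supports_restrict {J : Set I} {ψ : Formula I} (hψ : ψ.atoms ⊆ J) :
    Supports Sig (fun i => {w | i ∈ J ∧ w ∈ V i}) ψ s ↔ Supports Sig V ψ s := by
  induction ψ generalizing s with
  | atom i =>
    have hi : i ∈ J := hψ rfl
    simp [Supports, hi]
  | bot => exact Iff.rfl
  | and φ ψ ih₁ ih₂ =>
    have h := union_subset_iff.1 hψ
    simp only [Supports, ih₁ h.1, ih₂ h.2]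
  | imp φ ψ ih₁ ih₂ =>
    have h := union_subset_iff.1 hψ
    simp only [Supports, ih₁ h.1, ih₂ h.2]
  | idisj φ ψ ih₁ ih₂ =>
    have h := union_subset_iff.1 hψ
    simp only [Supports, ih₁ h.1, ih₂ h.2]
  | box φ ih => simp only [Supports, ih hψ]
  | boxplus φ ih => simp only [Supports, ih hψ]

end

/-- The predicates that occur in a two-sorted formula. -/
def FO.atoms : {m n : ℕ} → FO I m n → Set I
  | _, _, .falsum => ∅
  | _, _, .eqW _ _ => ∅
  | _, _, .eqS _ _ => ∅
  | _, _, .mem _ _ => ∅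
  | _, _, .E _ _ => ∅
  | _, _, .P i _ => {i}
  | _, _, .imp φ ψ => φ.atoms ∪ ψ.atoms
  | _, _, .allW φ => φ.atoms
  | _, _, .allS φ => φ.atoms

theorem FO.finite_atoms {m n : ℕ} (φ : FO I m n) : φ.atoms.Finite := by
  induction φ with
  | imp φ ψ ih₁ ih₂ => exact ih₁.union ih₂
  | allW φ ih => exact ih
  | allS φ ih => exact ih
  | P i x => exact finite_singleton i
  | _ => exact finite_empty

namespace RelPseudoModel

/-- The pseudo-model in which the predicates outside `J` are made empty. -/
abbrev restrict (A : RelPseudoModel.{u, v} I) (J : Set I) : RelPseudoModel.{u, v} I :=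
  { A with P := fun i w => i ∈ J ∧ A.P i w }

theorem realize_restrict (A : RelPseudoModel.{u, v} I) {J : Set I} {m n : ℕ} {φ : FO I m n}
    (hφ : φ.atoms ⊆ J) (e : Fin m → A.W) (f : Fin n → A.S) :
    (A.restrict J).Realize φ e f ↔ A.Realize φ e f := by
  induction φ with
  | imp φ ψ ih₁ ih₂ =>
    have h := union_subset_iff.1 hφ
    exact imp_congr (ih₁ h.1 e f) (ih₂ h.2 e f)
  | allW φ ih => exact forall_congr' fun w => ih hφ _ _
  | allS φ ih => exact forall_congr' fun s => ih hφ _ _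
  | P i x => exact and_iff_right (hφ rfl)
  | _ => exact Iff.rfl

theorem sat_restrict (A : RelPseudoModel.{u, v} I) {J : Set I} {φ : FO I 0 1}
    (hφ : φ.atoms ⊆ J) (s : A.S) : (A.restrict J).Sat s φ ↔ A.Sat s φ :=
  A.realize_restrict hφ _ _

theorem supp_restrict (A : RelPseudoModel.{u, v} I) {J : Set I} {ψ : Formula I}
    (hψ : ψ.atoms ⊆ J) (s : Set A.W) : (A.restrict J).Supp ψ s ↔ A.Supp ψ s :=
  supports_restrict hψ

end RelPseudoModel

end Atoms

/-! ### Bisimilarity of saturated pseudo-models -/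

section HennessyMilner

variable {I : Type u} {J : Set I} {A B : RelPseudoModel.{u, v} I}

/-- Equivalence of worlds with respect to modal formulae over `J`. -/
def WorldEquiv (J : Set I) (A B : RelPseudoModel.{u, v} I) (w : A.W) (w' : B.W) : Prop :=
  ∀ ψ : Formula I, ψ.atoms ⊆ J → (A.Supp ψ {w} ↔ B.Supp ψ {w'})

theorem WorldEquiv.symm {w : A.W} {w' : B.W} (h : WorldEquiv J A B w w') :
    WorldEquiv J B A w' w := fun ψ hψ => (h ψ hψ).symm

/-- At singletons negation is classical, so inclusion of theories is already equality. -/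
theorem worldEquiv_of_forall_imp {w : A.W} {w' : B.W}
    (h : ∀ ψ : Formula I, ψ.atoms ⊆ J → A.Supp ψ {w} → B.Supp ψ {w'}) :
    WorldEquiv J A B w w' := by
  refine fun ψ hψ => ⟨h ψ hψ, fun hB => ?_⟩
  by_contra hA
  have := h (ψ.imp .bot) (union_subset hψ (empty_subset J))
    (supports_neg.2 fun x hx => by rwa [mem_singleton_iff.1 hx])
  exact supports_neg.1 this w' rfl hB

/-- If a finite part of the theory of `w` held at no world of `b`, the negation of its conjunction
would be supported at `b`, hence at `s`, contradicting `w ∈ s`. Saturation then realises the whole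
theory inside `b`. -/
theorem exists_worldEquiv (hJ : J.Countable) (hB : B.IsSaturated) {s : Set A.W} {b : B.S}
    (h : ∀ ψ : Formula I, ψ.atoms ⊆ J → B.Supp ψ (B.ext b) → A.Supp ψ s) {w : A.W} (hw : w ∈ s) :
    ∃ w' ∈ B.ext b, WorldEquiv J A B w w' := by
  classical
  obtain ⟨ψ, hψ⟩ := exists_enumeration hJ
  have hψJ : ∀ k, (ψ k).atoms ⊆ J := fun k => hψ.symm.subset ⟨k, rfl⟩
  obtain ⟨w', hw'⟩ := hB.world
    (fun k => (FO.mem 0 0).and (if A.Supp (ψ k) {w} then ST (ψ k) id else FO.verum)) b fun K => by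
      let l := ((List.range K).map ψ).filter fun χ => A.Supp χ {w}
      have hl : ∀ χ ∈ l, χ.atoms ⊆ J := by
        intro χ hχ
        obtain ⟨k, -, rfl⟩ := List.mem_map.1 (List.mem_filter.1 hχ).1
        exact hψJ k
      have hn : ¬ B.Supp ((Formula.conj l).imp .bot) (B.ext b) := by
        intro hb
        refine supports_neg.1 (h _ (union_subset (Formula.atoms_conj hl) (empty_subset J)) hb) w hw
          (supports_conj.2 fun χ hχ => ?_)
        simpa using (List.mem_filter.1 hχ).2
      rw [RelPseudoModel.Supp, supports_neg] at hn
      push Not at hn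
      obtain ⟨x, hx, hc⟩ := hn
      refine ⟨x, fun k hk => (B.realize_and _ _ _ _).2 ⟨hx, ?_⟩⟩
      split_ifs with hA
      · rw [B.realize_ST, range_const]
        refine supports_conj.1 hc _ (List.mem_filter.2 ⟨List.mem_map.2 ⟨k, ?_, rfl⟩, ?_⟩)
        · simpa using hk
        · simpa using hA
      · exact B.realize_verum _ _
  simp only [RelStructure.realize_and] at hw'
  refine ⟨w', (hw' 0).1, worldEquiv_of_forall_imp fun χ hχ hA => ?_⟩
  obtain ⟨k, rfl⟩ := hψ.subset hχ
  have := (hw' k).2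
  rwa [if_pos hA, B.realize_ST, range_const] at this

/-- Given finitely many formulae failing at `a`, the formula `⊞` of their inquisitive disjunction
fails at `w`, hence at `w'`, so some state in `E[w']` supports none of them. Saturation finds one
state avoiding all formulae that fail at `a`. -/
theorem exists_state_of_worldEquiv (hJ : J.Countable) (hB : B.IsSaturated) {w : A.W} {w' : B.W}
    (h : WorldEquiv J A B w w') {a : A.S} (ha : A.E w a) :
    ∃ b, B.E w' b ∧
      ∀ ψ : Formula I, ψ.atoms ⊆ J → B.Supp ψ (B.ext b) → A.Supp ψ (A.ext a) := by
  classical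
  -- An empty `a` supports everything, so any successor state will do.
  rcases (A.ext a).eq_empty_or_nonempty with hemp | hne
  · obtain ⟨b, hb⟩ := B.nonempty_E w'
    refine ⟨b, hb, fun ψ _ _ => ?_⟩
    rw [hemp]
    exact supports_empty ψ
  obtain ⟨ψ, hψ⟩ := exists_enumeration hJ
  have hψJ : ∀ k, (ψ k).atoms ⊆ J := fun k => hψ.symm.subset ⟨k, rfl⟩
  obtain ⟨b, hb⟩ := hB.state
    (fun k => (FO.E 0 0).and
      (if A.Supp (ψ k) (A.ext a) then FO.verum else (stateTranslation (ψ k) 0).neg)) w' fun K => by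
      let l := ((List.range K).map ψ).filter fun χ => ¬ A.Supp χ (A.ext a)
      have hl : ∀ χ ∈ l, χ.atoms ⊆ J := by
        intro χ hχ
        obtain ⟨k, -, rfl⟩ := List.mem_map.1 (List.mem_filter.1 hχ).1
        exact hψJ k
      have hn : ¬ B.Supp (Formula.disj l).boxplus {w'} := by
        rw [← h (.boxplus (.disj l)) (Formula.atoms_disj hl)]
        intro hA
        obtain ⟨χ, hχ, hs⟩ := (supports_disj hne).1 (hA w rfl _ ⟨a, ha, rfl⟩)
        exact absurd hs (by simpa using (List.mem_filter.1 hχ).2)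
      simp only [RelPseudoModel.Supp, Supports, mem_singleton_iff, forall_eq, not_forall] at hn
      obtain ⟨_, ⟨b, hb, rfl⟩, hn⟩ := hn
      have hbne : (B.ext b).Nonempty := by
        by_contra hemp
        rw [not_nonempty_iff_eq_empty.1 hemp] at hn
        exact hn (supports_empty _)
      rw [supports_disj hbne] at hn
      refine ⟨b, fun k hk => (B.realize_and _ _ _ _).2 ⟨hb, ?_⟩⟩
      split_ifs with hA
      · exact B.realize_verum _ _
      · rw [B.realize_neg, B.realize_stateTranslation]
        refine fun hs => hn ⟨ψ k, List.mem_filter.2 ⟨List.mem_map.2 ⟨k, ?_, rfl⟩, ?_⟩, hs⟩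
        · simpa using hk
        · simpa using hA
  simp only [RelStructure.realize_and] at hb
  refine ⟨b, (hb 0).1, fun χ hχ hs => ?_⟩
  obtain ⟨k, rfl⟩ := hψ.subset hχ
  by_contra hA
  have := (hb k).2
  rw [if_neg hA, B.realize_neg, B.realize_stateTranslation] at this
  exact this hs

/-- The state `b` found by saturation may contain worlds without a partner in `t`. Discarding them
stays inside `Σ↓(w')`, so one-sided inclusion of theories is enough. -/
theorem worldEquiv_forth (hJ : J.Countable) (hB : B.IsSaturated) {w : A.W} {w' : B.W}
    (h : WorldEquiv J A B w w') {t : Set A.W} (ht : t ∈ A.decode.closure.Sig w) :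
    ∃ t' ∈ B.decode.closure.Sig w', SetLift (WorldEquiv J A B) t t' := by
  obtain ⟨_, ⟨a, ha, rfl⟩, hta⟩ := ht
  obtain ⟨b, hb, hab⟩ := exists_state_of_worldEquiv hJ hB h ha
  refine ⟨{v ∈ B.ext b | ∃ u ∈ t, WorldEquiv J A B u v}, ⟨_, ⟨b, hb, rfl⟩, sep_subset _ _⟩,
    fun u hu => ?_, fun v hv => hv.2⟩
  obtain ⟨v, hv, huv⟩ := exists_worldEquiv hJ hB hab (hta hu)
  exact ⟨v, ⟨hv, u, hu, huv⟩, huv⟩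

theorem SetLift.symm {W W' : Type*} {Z : W → W' → Prop} {Z' : W' → W → Prop} {s : Set W}
    {s' : Set W'} (h : SetLift Z s s') (hZ : ∀ w w', Z w w' → Z' w' w) : SetLift Z' s' s :=
  ⟨fun w' hw' => let ⟨w, hw, hz⟩ := h.2 w' hw'; ⟨w, hw, hZ _ _ hz⟩,
    fun w hw => let ⟨w', hw', hz⟩ := h.1 w hw; ⟨w', hw', hZ _ _ hz⟩⟩

theorem RelPseudoModel.decode_inqClosure_Sig (A : RelPseudoModel.{u, v} I) (s : A.S) (w : A.W) :
    (A.inqClosure s).decode.Sig w = A.decode.closure.Sig w := by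
  ext t
  refine ⟨?_, fun ht => ⟨⟨t, Or.inl ⟨w, ht⟩⟩, ht, rfl⟩⟩
  rintro ⟨b, hb, rfl⟩
  exact hb

/-- Between inquisitive closures of saturated pseudo-models, modal equivalence of worlds is a
bisimulation. -/
theorem isBisimulation_worldEquiv (hJ : J.Countable) (hA : A.IsSaturated) (hB : B.IsSaturated)
    (hPA : ∀ i w, A.P i w → i ∈ J) (hPB : ∀ i w, B.P i w → i ∈ J) (s : A.S) (s' : B.S) :
    IsBisimulation (A.inqClosure s).decode (B.inqClosure s').decode
      (WorldEquiv J A B) (SetLift (WorldEquiv J A B)) where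
  atoms w w' h i := by
    by_cases hi : i ∈ J
    · have := h (.atom i) (singleton_subset_iff.2 hi)
      simp only [RelPseudoModel.Supp, Supports, singleton_subset_iff] at this
      exact this
    · exact iff_of_false (fun hw => hi (hPA i w hw)) fun hw => hi (hPB i w' hw)
  world_forth w w' h t ht := by
    rw [A.decode_inqClosure_Sig] at ht
    rw [B.decode_inqClosure_Sig]
    exact worldEquiv_forth hJ hB h ht
  world_back w w' h t ht := by
    rw [B.decode_inqClosure_Sig] at ht
    rw [A.decode_inqClosure_Sig]
    obtain ⟨t', ht', hl⟩ := worldEquiv_forth hJ hA h.symm ht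
    exact ⟨t', ht', hl.symm fun _ _ => WorldEquiv.symm⟩
  state_forth _ _ h := h.1
  state_back _ _ h := h.2

/-- A persistent, closure- and bisimulation-invariant formula transfers between saturated
pseudo-models along inclusion of modal theories. -/
theorem sat_of_isSaturated {φ : FO I 0 1} (hc : PreservedUnderClosure.{u, v} φ)
    (hcn : PreservedUnderClosure.{u, v} φ.neg) (hb : PreservedUnderBisimulation.{u, v} φ)
    (hp : PersistentOverClosures.{u, v} φ) (hJ : J.Countable) (hA : A.IsSaturated)
    (hB : B.IsSaturated) (hPA : ∀ i w, A.P i w → i ∈ J) (hPB : ∀ i w, B.P i w → i ∈ J)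
    {s : A.S} {t : B.S} (hs : (A.ext s).Nonempty) (ht : (B.ext t).Nonempty)
    (h : ∀ ψ : Formula I, ψ.atoms ⊆ J → B.Supp ψ (B.ext t) → A.Supp ψ (A.ext s))
    (hφ : B.Sat t φ) : A.Sat s φ := by
  -- The part of `t` that is bisimilar to `s`: persistence brings `φ` from `t` to `r`, and
  -- bisimulation from `r` to `s`.
  let r : Set B.W := {v ∈ B.ext t | ∃ u ∈ A.ext s, WorldEquiv J A B u v}
  have hr : r ⊆ B.ext t := sep_subset _ _
  have hlift : SetLift (WorldEquiv J A B) (A.ext s) r := by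
    refine ⟨fun u hu => ?_, fun v hv => hv.2⟩
    obtain ⟨v, hv, huv⟩ := exists_worldEquiv hJ hB h hu
    exact ⟨v, ⟨hv, u, hu, huv⟩, huv⟩
  have hrne : r.Nonempty := by
    obtain ⟨u, hu⟩ := hs
    obtain ⟨v, hv, -⟩ := hlift.1 u hu
    exact ⟨v, hv⟩
  have h₁ := hp B t (hc B t ht hφ) r hr hrne
  have h₂ := hb _ _ (B.isModel_inqClosure t) (A.isModel_inqClosure s) (B.substate t r hr)
    (A.substate s (A.ext s) subset_rfl) hrne hs
    ⟨WorldEquiv J B A, SetLift (WorldEquiv J B A), isBisimulation_worldEquiv hJ hB hA hPB hPA t s,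
      hlift.symm fun _ _ => WorldEquiv.symm⟩ h₁
  -- `φ` is now known only in the closure of `A`; preservation of `¬φ` pulls it back to `A`.
  by_contra hn
  exact hcn A s hs hn h₂

end HennessyMilner

/-! ### Expressive completeness -/

section Completeness

variable {I : Type u} {φ : FO I 0 1}

/-- The formula `θ` is the disjunction, over sublists `r` of `l` that include all listed formulae
supported at some state satisfying `φ`, of the conjunction of `r`. It follows from `φ`; as it is not
equivalent to `φ`, some state supports `θ` and refutes `φ`, and a supported disjunct supplies the
partner. -/
theorem exists_separating_models
    (hne : ∀ ψ : Formula I, ¬ EquivalentOnNonemptyStates.{u, v} φ (standardTranslation ψ))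
    (l : List (Formula I)) :
    ∃ (A B : RelPseudoModel.{u, v} I) (s : A.S) (t : B.S), (A.ext s).Nonempty ∧
      (B.ext t).Nonempty ∧ ¬ A.Sat s φ ∧ B.Sat t φ ∧
        ∀ ψ ∈ l, B.Supp ψ (B.ext t) → A.Supp ψ (A.ext s) := by
  classical
  let θ : Formula I := Formula.disj <| (l.sublists.filter fun r =>
    ∃ (B : RelPseudoModel.{u, v} I) (t : B.S), (B.ext t).Nonempty ∧ B.Sat t φ ∧
      ∀ ψ ∈ l, B.Supp ψ (B.ext t) → ψ ∈ r).map Formula.conj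
  have hθ : ∀ (B : RelPseudoModel.{u, v} I) (t : B.S), (B.ext t).Nonempty → B.Sat t φ →
      B.Supp θ (B.ext t) := by
    intro B t ht hφ
    refine (supports_disj ht).2 ⟨Formula.conj (l.filter fun ψ => B.Supp ψ (B.ext t)),
      List.mem_map.2 ⟨_, List.mem_filter.2 ⟨List.mem_sublists.2 List.filter_sublist, ?_⟩, rfl⟩,
      supports_conj.2 fun ψ hψ => ?_⟩
    · simp only [decide_eq_true_eq]
      exact ⟨B, t, ht, hφ, fun ψ hψ hs => List.mem_filter.2 ⟨hψ, by simpa using hs⟩⟩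
    · simpa using (List.mem_filter.1 hψ).2
  have := hne θ
  simp only [EquivalentOnNonemptyStates, not_forall] at this
  obtain ⟨A, s, hs, hn⟩ := this
  rw [A.sat_standardTranslation] at hn
  have hA : A.Supp θ (A.ext s) ∧ ¬ A.Sat s φ := by
    have := hθ A s hs
    tauto
  obtain ⟨χ, hχ, hsupp⟩ := (supports_disj hs).1 hA.1
  obtain ⟨r, hr, rfl⟩ := List.mem_map.1 hχ
  have hr' := (List.mem_filter.1 hr).2
  simp only [decide_eq_true_eq] at hr'
  obtain ⟨B, t, ht, hφ, hB⟩ := hr'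
  exact ⟨A, B, s, t, hs, ht, hA.2, hφ, fun ψ hψ hBψ => supports_conj.1 hsupp ψ (hB ψ hψ hBψ)⟩

namespace RelPseudoModel

variable (U : Ultrafilter ℕ) (A : ℕ → RelPseudoModel.{u, v} I) (s : ∀ n, (A n).S)

/-- The state of an ultraproduct given by a sequence of states. -/
def ultraproductState : (ultraproduct U A).S :=
  Quotient.mk (productSetoid (U : Filter ℕ) fun n => (A n).S) s

theorem nonempty_ext_ultraproductState (hs : ∀ n, ((A n).ext (s n)).Nonempty) :
    ((ultraproduct U A).ext (ultraproductState U A s)).Nonempty := by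
  choose w hw using hs
  refine ⟨Quotient.mk (productSetoid (U : Filter ℕ) fun n => (A n).W) w, ?_⟩
  filter_upwards [eventually_out_mk_eq (U : Filter ℕ) s, eventually_out_mk_eq (U : Filter ℕ) w]
    with n h₁ h₂
  have := hw n
  rw [← h₁, ← h₂] at this
  exact this

theorem sat_ultraproductState (φ : FO I 0 1) :
    (ultraproduct U A).Sat (ultraproductState U A s) φ ↔ ∀ᶠ n in U, (A n).Sat (s n) φ :=
  RelStructure.sat_ultraproduct_mk U (fun n => (A n).toRelStructure) s φ

/-- Łoś's theorem applies to support because the standard translation makes it first-order. -/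
theorem supp_ultraproductState (ψ : Formula I) :
    (ultraproduct U A).Supp ψ ((ultraproduct U A).ext (ultraproductState U A s)) ↔
      ∀ᶠ n in U, (A n).Supp ψ ((A n).ext (s n)) := by
  simp only [← sat_standardTranslation, sat_ultraproductState]

end RelPseudoModel

theorem exists_equivalent_standardTranslation (hc : PreservedUnderClosure.{u, v} φ)
    (hcn : PreservedUnderClosure.{u, v} φ.neg) (hb : PreservedUnderBisimulation.{u, v} φ)
    (hp : PersistentOverClosures.{u, v} φ) :
    ∃ ψ : Formula I, EquivalentOnNonemptyStates.{u, v} φ (standardTranslation ψ) := by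
  by_contra! hne
  have hJ : φ.atoms.Countable := φ.finite_atoms.countable
  obtain ⟨ψ, hψ⟩ := exists_enumeration hJ
  have hψJ : ∀ k, (ψ k).atoms ⊆ φ.atoms := fun k => hψ.symm.subset ⟨k, rfl⟩
  choose A B s t hs ht hA hB hAB using fun n =>
    exists_separating_models.{u, v} hne ((List.range n).map ψ)
  let U := hyperfilter ℕ
  have hU : (U : Filter ℕ) ≤ atTop := Nat.hyperfilter_le_atTop
  -- Emptying the predicates that `φ` does not mention makes worlds agree on them trivially, so
  -- equivalence over the finitely many variables of `φ` yields a bisimulation for all of them.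
  let A' := fun n => (A n).restrict φ.atoms
  let B' := fun n => (B n).restrict φ.atoms
  have hP : ∀ (C : ℕ → RelPseudoModel.{u, v} I) i w,
      (RelPseudoModel.ultraproduct U fun n => (C n).restrict φ.atoms).P i w → i ∈ φ.atoms :=
    fun C i w h => (Eventually.exists (f := (U : Filter ℕ)) h).choose_spec.1
  have key : (RelPseudoModel.ultraproduct U A').Sat (RelPseudoModel.ultraproductState U A' s) φ := by
    refine sat_of_isSaturated hc hcn hb hp hJ (RelPseudoModel.isSaturated_ultraproduct hU A')
      (RelPseudoModel.isSaturated_ultraproduct hU B') (hP A) (hP B)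
      (RelPseudoModel.nonempty_ext_ultraproductState U A' s hs) (RelPseudoModel.nonempty_ext_ultraproductState U B' t ht) ?_
      ((RelPseudoModel.sat_ultraproductState U B' t φ).2 (Eventually.of_forall fun n =>
        ((B n).sat_restrict subset_rfl _).2 (hB n)))
    intro χ hχ h
    obtain ⟨k, rfl⟩ := hψ.subset hχ
    refine (RelPseudoModel.supp_ultraproductState U A' s _).2 ?_
    -- The `n`-th pair respects only the first `n` formulae, so `ψ k` transfers at every index `n >
    -- k`, that is, almost everywhere.
    filter_upwards [(RelPseudoModel.supp_ultraproductState U B' t _).1 h, hU (eventually_gt_atTop k)] with n h₁ h₂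
    refine ((A n).supp_restrict hχ _).2 (hAB n _ ?_ (((B n).supp_restrict hχ _).1 h₁))
    exact List.mem_map.2 ⟨k, List.mem_range.2 h₂, rfl⟩
  obtain ⟨n, hn⟩ := ((RelPseudoModel.sat_ultraproductState U A' s φ).1 key).exists
  exact hA n (((A n).sat_restrict subset_rfl _).1 hn)

end Completeness

end InqML

theorem mainTheorem4 {I : Type u} (φ : InqML.FO I 0 1) :
    ((InqML.PreservedUnderClosure.{u, v} φ ∧ InqML.PreservedUnderClosure.{u, v} φ.neg) ∧
      InqML.PreservedUnderBisimulation.{u, v} φ ∧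
      InqML.PersistentOverClosures.{u, v} φ) ↔
    ∃ ψ : InqML.Formula I,
      InqML.EquivalentOnNonemptyStates.{u, v} φ (InqML.standardTranslation ψ) := by
  constructor
  · rintro ⟨⟨hc, hcn⟩, hb, hp⟩
    exact InqML.exists_equivalent_standardTranslation hc hcn hb hp
  · rintro ⟨ψ, h⟩
    exact ⟨h.preservedUnderClosure, h.preservedUnderBisimulation, h.persistentOverClosures⟩
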